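/- Let $\mathbb{N}=\{1,2,\dots\}$ and $\mathbb{N}_0=\mathbb{N}\cup\{0\}$. An infinite sequence $(e_i)_{i\ge 1}$ in $\mathbb{N}_0$ is called a binomid index if $\sum_{i=n-k+1}^{n} e_i\ge \sum_{i=1}^{k} e_i$ for all integers $1\le k\le n$; a finite sequence $(e_i)_{i\le m}$ in $\mathbb{N}_0$ is called a binomid index of length $m$ if this inequality holds for all $1\le k\le n\le m$. For $k\in\mathbb{N}$ let $\mathbb{I}_k$ be the set of binomid indices of length $k$, and for $\eta\in\mathbb{I}_k$ let $L_k(\eta)$ be the lex-minimal extension of $\eta$, that is, the lexicographically smallest infinite binomid index whose first $k$ entries are $\eta$ (it exists and is unique). Let $\mathbb{L}=\bigcup_{k\in\mathbb{N}}L_k(\mathbb{I}_k)$ be the set of all lex-minimal extensions, and let $\mathbf{Atom}$ be the set of nonzero infinite binomid indices that are not the sum of two nonzero infinite binomid indices. For a set $A$ of sequences, $\langle A\rangle$ denotes the submonoid of $(\mathbb{N}_0)^{\mathbb{N}}$ (under componentwise addition) generated by $A$. Theorem. The set $\mathbb{L}$ is a submonoid of $(\mathbb{N}_0)^{\mathbb{N}}$.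 The submonoids $\langle L_k(\mathbb{I}_k)\rangle$, $k\in\mathbb{N}$, form an increasing chain, each of them is a finitely presented commutative monoid, and $\mathbb{L}$ is the inductive limit of this chain along the inclusions: $\mathbb{L}=\bigcup_{k\in\mathbb{N}}\langle L_k(\mathbb{I}_k)\rangle$, and $\mathbb{L}$ has the universal property of the colimit in the category of commutative monoids. Moreover, the sets $\mathbf{Atom}\cap L_k(\mathbb{I}_k)$, $k\in\mathbb{N}$, are increasing in $k$, and $\langle \mathbf{Atom}\cap L_k(\mathbb{I}_k)\rangle=\langle L_k(\mathbb{I}_k)\rangle$ for every $k\in\mathbb{N}$. -/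

import Mathlib

universe u

namespace Binomid

/-! Sequences are indexed from `0` in the code: an infinite sequence `(e₁, e₂, …)` is the function
`e : ℕ → ℕ` with `e i = e_{i+1}`, and a finite one of length `k` is a function on `Fin k`. -/

/-- Infinite binomid indices: the sum of the `k` entries ending at position `n` is at least
the sum of the first `k` entries, for all `1 ≤ k ≤ n`. -/
def IsBinomid (e : ℕ → ℕ) : Prop :=
  ∀ k n : ℕ, 1 ≤ k → k ≤ n →
    ∑ i ∈ Finset.range k, e i ≤ ∑ i ∈ Finset.Ico (n - k) n, e i

/-- Binomid indices of finite length `m`: the same condition for all `1 ≤ k ≤ n ≤ m`. -/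
def IsFinBinomid {m : ℕ} (μ : Fin m → ℕ) : Prop :=
  ∀ k n : ℕ, 1 ≤ k → k ≤ n → n ≤ m →
    ∑ i : Fin m with i.val < k, μ i ≤ ∑ i : Fin m with n - k ≤ i.val ∧ i.val < n, μ i

/-- The set `𝕀_k` of binomid indices of length `k`. -/
def FinIndex (k : ℕ) : Type := {μ : Fin k → ℕ // IsFinBinomid μ}

/-- The infinite sequence `e` extends the finite sequence `μ`. -/
def Extends {k : ℕ} (e : ℕ → ℕ) (μ : Fin k → ℕ) : Prop := ∀ i : Fin k, e i = μ i

/-- `e` is the lexicographically least infinite binomid index that extends `μ`. -/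
def IsLexMinExt {k : ℕ} (μ : Fin k → ℕ) (e : ℕ → ℕ) : Prop :=
  IsBinomid e ∧ Extends e μ ∧
    ∀ e' : ℕ → ℕ, IsBinomid e' → Extends e' μ → toLex e ≤ toLex e'

/-- Partial sums of the extension of `μ`, used to show that the lex-minimal extension exists. -/
def greedySum {k : ℕ} (μ : Fin k → ℕ) (n : ℕ) : ℕ :=
  if n ≤ k then ∑ i : Fin k with i.val < n, μ i
  else (Finset.Ico 1 n).attach.sup fun i => greedySum μ i.1 + greedySum μ (n - i.1)
termination_by n
decreasing_by
  all_goals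
    have := Finset.mem_Ico.1 i.2
    omega

theorem sum_lt_eq {k : ℕ} (μ : Fin k → ℕ) (e : ℕ → ℕ) (he : Extends e μ) (n : ℕ) (hn : n ≤ k) :
    ∑ i : Fin k with i.val < n, μ i = ∑ i ∈ Finset.range n, e i := by
  have h1 : ∑ i : Fin k with i.val < n, μ i = ∑ i : Fin k with i.val < n, e i :=
    Finset.sum_congr rfl fun i _ => (he i).symm
  rw [h1, Finset.sum_filter, Fin.sum_univ_eq_sum_range (fun i => if i < n then e i else 0) k,
    ← Finset.sum_filter]
  congr 1
  ext i
  simp only [Finset.mem_filter, Finset.mem_range]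
  omega

theorem sum_between_eq {k : ℕ} (μ : Fin k → ℕ) (e : ℕ → ℕ) (he : Extends e μ) (a n : ℕ)
    (hn : n ≤ k) :
    ∑ i : Fin k with a ≤ i.val ∧ i.val < n, μ i = ∑ i ∈ Finset.Ico a n, e i := by
  have h1 : ∑ i : Fin k with a ≤ i.val ∧ i.val < n, μ i
      = ∑ i : Fin k with a ≤ i.val ∧ i.val < n, e i :=
    Finset.sum_congr rfl fun i _ => (he i).symm
  rw [h1, Finset.sum_filter,
    Fin.sum_univ_eq_sum_range (fun i => if a ≤ i ∧ i < n then e i else 0) k, ← Finset.sum_filter]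
  congr 1
  ext i
  simp only [Finset.mem_filter, Finset.mem_range, Finset.mem_Ico]
  omega

theorem isBinomid_iff (e : ℕ → ℕ) : IsBinomid e ↔ ∀ i j : ℕ,
    ∑ l ∈ Finset.range i, e l + ∑ l ∈ Finset.range j, e l ≤ ∑ l ∈ Finset.range (i + j), e l := by
  constructor
  · intro h i j
    rcases Nat.eq_zero_or_pos j with rfl | hj
    · simp
    · have h1 := h j (i + j) hj (by omega)
      have h2 := Finset.sum_range_add_sum_Ico e (show i + j - j ≤ i + j by omega)
      rw [Nat.add_sub_cancel] at h1 h2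
      omega
  · intro h k n _ hkn
    have h1 := h (n - k) k
    have h2 := Finset.sum_range_add_sum_Ico e (show n - k ≤ n by omega)
    rw [Nat.sub_add_cancel hkn] at h1
    omega

theorem greedySum_le {k : ℕ} (μ : Fin k → ℕ) (n : ℕ) (hn : n ≤ k) :
    greedySum μ n = ∑ i : Fin k with i.val < n, μ i := by
  rw [greedySum, if_pos hn]

theorem greedySum_zero {k : ℕ} (μ : Fin k → ℕ) : greedySum μ 0 = 0 := by
  rw [greedySum_le μ 0 (Nat.zero_le _)]
  simp

theorem greedySum_add {k : ℕ} (μ : Fin k → ℕ) (hμ : IsFinBinomid μ) (i j : ℕ) :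
    greedySum μ i + greedySum μ j ≤ greedySum μ (i + j) := by
  rcases Nat.eq_zero_or_pos i with rfl | hi
  · simp [greedySum_zero]
  rcases Nat.eq_zero_or_pos j with rfl | hj
  · simp [greedySum_zero]
  by_cases h : i + j ≤ k
  · rw [greedySum_le μ i (by omega), greedySum_le μ j (by omega), greedySum_le μ _ h]
    let e : ℕ → ℕ := fun l => if h : l < k then μ ⟨l, h⟩ else 0
    have he : Extends e μ := fun l => by simp [e]
    have h1 := hμ j (i + j) hj (by omega) h
    rw [sum_lt_eq μ e he j (by omega), sum_between_eq μ e he _ _ h, Nat.add_sub_cancel] at h1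
    rw [sum_lt_eq μ e he i (by omega), sum_lt_eq μ e he j (by omega), sum_lt_eq μ e he _ h]
    have h2 := Finset.sum_range_add_sum_Ico e (show i ≤ i + j by omega)
    omega
  · have hm : i ∈ Finset.Ico 1 (i + j) := Finset.mem_Ico.2 ⟨hi, by omega⟩
    conv_rhs => rw [greedySum, if_neg h]
    have := Finset.le_sup (f := fun l : {x // x ∈ Finset.Ico 1 (i + j)} =>
      greedySum μ l.1 + greedySum μ (i + j - l.1)) (Finset.mem_attach _ ⟨i, hm⟩)
    simpa using this

theorem exists_isLexMinExt {k : ℕ} (μ : Fin k → ℕ) (hμ : IsFinBinomid μ) :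
    ∃ e : ℕ → ℕ, IsLexMinExt μ e := by
  have hmono : Monotone (greedySum μ) := by
    intro a b hab
    have := greedySum_add μ hμ a (b - a)
    rw [Nat.add_sub_cancel' hab] at this
    omega
  let e : ℕ → ℕ := fun n => greedySum μ (n + 1) - greedySum μ n
  have hsum : ∀ n, ∑ i ∈ Finset.range n, e i = greedySum μ n := by
    intro n
    rw [Finset.sum_range_tsub hmono, greedySum_zero, Nat.sub_zero]
  have hext : Extends e μ := by
    intro i
    let e' : ℕ → ℕ := fun l => if h : l < k then μ ⟨l, h⟩ else 0
    have he : Extends e' μ := fun l => by simp [e']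
    have hi := i.2
    change greedySum μ (i + 1) - greedySum μ i = μ i
    rw [greedySum_le μ _ (by omega), greedySum_le μ _ (by omega), sum_lt_eq μ e' he _ (by omega),
      sum_lt_eq μ e' he _ (by omega), Finset.sum_range_succ, he i]
    omega
  refine ⟨e, ?_, hext, ?_⟩
  · rw [isBinomid_iff]
    intro i j
    simp only [hsum]
    exact greedySum_add μ hμ i j
  · intro e' hb hx
    by_contra hlt
    obtain ⟨n, hn, hlt⟩ := not_le.1 hlt
    have hn' : ∀ j < n, e' j = e j := hn
    have hlt' : e' n < e n := hlt
    have hnk : k ≤ n := by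
      by_contra hc
      have h1 := hx ⟨n, by omega⟩
      have h2 := hext ⟨n, by omega⟩
      simp only at h1 h2
      omega
    have hS : ∀ j ≤ n, ∑ i ∈ Finset.range j, e' i = greedySum μ j := by
      intro j hj
      rw [← hsum]
      exact Finset.sum_congr rfl fun l hl => hn' l (by have := Finset.mem_range.1 hl; omega)
    have hle : greedySum μ (n + 1) ≤ ∑ i ∈ Finset.range (n + 1), e' i := by
      rw [greedySum, if_neg (by omega)]
      refine Finset.sup_le fun l _ => ?_
      have hl := Finset.mem_Ico.1 l.2
      have h1 := (isBinomid_iff e').1 hb l.1 (n + 1 - l.1)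
      rw [Nat.add_sub_cancel' (by omega)] at h1
      rwa [hS _ (by omega), hS _ (by omega)] at h1
    rw [← hsum, Finset.sum_range_succ, Finset.sum_range_succ, hS n le_rfl, hsum] at hle
    omega

theorem isLexMinExt_unique {k : ℕ} {μ : Fin k → ℕ} {e e' : ℕ → ℕ}
    (h : IsLexMinExt μ e) (h' : IsLexMinExt μ e') : e = e' :=
  toLex.injective (le_antisymm (h.2.2 e' h'.1 h'.2.1) (h'.2.2 e h.1 h.2.1))

/-- The map `L_k`, sending a binomid index of length `k` to its lex-minimal extension. -/
noncomputable def L (k : ℕ) (μ : FinIndex k) : ℕ → ℕ :=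
  Classical.choose (exists_isLexMinExt μ.1 μ.2)

theorem L_spec (k : ℕ) (μ : FinIndex k) : IsLexMinExt μ.1 (L k μ) :=
  Classical.choose_spec (exists_isLexMinExt μ.1 μ.2)

/-- The set `𝕃` of all lex-minimal extensions of finite binomid indices. -/
def LexMin : Set (ℕ → ℕ) := {e | ∃ (k : ℕ+) (μ : FinIndex k), e = L k μ}

/-- `Atom`: the nonzero binomid indices that are not a sum of two nonzero binomid indices. -/
def Atom : Set (ℕ → ℕ) :=
  {e | IsBinomid e ∧ e ≠ 0 ∧
    ¬ ∃ e₁ e₂ : ℕ → ℕ, IsBinomid e₁ ∧ IsBinomid e₂ ∧ e₁ ≠ 0 ∧ e₂ ≠ 0 ∧ e = e₁ + e₂}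

/-- The submonoid `⟨L_k(𝕀_k)⟩` of the monoid of sequences under componentwise addition. -/
def spanL (k : ℕ+) : AddSubmonoid (ℕ → ℕ) := AddSubmonoid.closure (Set.range (L k))

/-- A commutative monoid is finitely presented if it is the quotient of a free commutative monoid
of finite rank by the congruence generated by finitely many pairs. -/
def IsFinitelyPresented (M : Type*) [AddCommMonoid M] : Prop :=
  ∃ (n : ℕ) (φ : (Fin n →₀ ℕ) →+ M) (R : Set ((Fin n →₀ ℕ) × (Fin n →₀ ℕ))),
    Function.Surjective φ ∧ R.Finite ∧ addConGen (fun x y => (x, y) ∈ R) = AddCon.ker φ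

/-- `T` is the inductive limit, in commutative monoids, of the submonoids `A k` along the
inclusions: the `A k` lie in `T`, and every family of homomorphisms on the `A k` that is compatible
with the inclusions `A j ⊆ A k` for `j ≤ k` factors through a unique homomorphism on `T`. -/
def IsInductiveLimit {M ι : Type*} [AddCommMonoid M] [Preorder ι]
    (A : ι → AddSubmonoid M) (T : AddSubmonoid M) : Prop :=
  ∃ hT : ∀ k, A k ≤ T, ∀ (N : Type u) [AddCommMonoid N] (f : ∀ k, A k →+ N),
    (∀ j k, j ≤ k → ∀ (x : M) (hj : x ∈ A j) (hk : x ∈ A k), f k ⟨x, hk⟩ = f j ⟨x, hj⟩) →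
    ∃! g : T →+ N, ∀ (k : ι) (x : A k), g (AddSubmonoid.inclusion (hT k) x) = f k x

end Binomid

/-! Being binomid means that the partial sums S are superadditive: S(i) + S(j) ≤ S(i+j). The
lex-minimal extension keeps each S(n) with n > k as small as this permits. Hence for k ≥ 1 the range
of `L k` consists of the k-tight indices: every n > k has some 0 < i < n with S(n) = S(i) + S(n-i)
(`mem_range_L`). Tightness weakens as k grows, which gives the chains. It passes to summands, so
decomposing into atoms never leaves the range of `L k`.

The core is `IsTight.exists_period`: a single d ≤ k, of maximal slope S(d)/d, splits off from every
n > k². Two tight indices then share a common multiple of their periods, so their sum is tight for a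
larger bound and `LexMin` is closed under addition. The period also leaves only finitely many
splitting patterns to consider. The indices obeying a given pattern form a monoid `face`, finitely
generated by Dickson's lemma in finitely many coordinates. So `spanL k` is finitely generated, and
Rédei's theorem makes it finitely presented. -/

namespace Binomid

/-! ### Finite presentation and inductive limits of commutative monoids -/

/-- **Rédei's theorem**: a finitely generated commutative monoid is finitely presented. -/
theorem isFinitelyPresented_of_fg (M : Type*) [AddCommMonoid M] [AddMonoid.FG M] :
    IsFinitelyPresented M := by
  have : Module.Finite ℕ M := Module.Finite.iff_addMonoid_fg.2 inferInstance
  obtain ⟨n, f, hf⟩ := Module.Finite.exists_fin' ℕ M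
  let φ : (Fin n →₀ ℕ) →+ M :=
    (f.comp (Finsupp.linearEquivFunOnFinite ℕ ℕ (Fin n)).toLinearMap).toAddMonoidHom
  have hφ : Function.Surjective φ :=
    hf.comp (Finsupp.linearEquivFunOnFinite ℕ ℕ (Fin n)).surjective
  have : IsNoetherianRing (AddMonoidAlgebra ℤ (Fin n →₀ ℕ)) :=
    inferInstanceAs (IsNoetherianRing (MvPolynomial (Fin n) ℤ))
  let δ : (Fin n →₀ ℕ) × (Fin n →₀ ℕ) → AddMonoidAlgebra ℤ (Fin n →₀ ℕ) := fun p =>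
    AddMonoidAlgebra.single p.1 1 - AddMonoidAlgebra.single p.2 1
  let K : Set ((Fin n →₀ ℕ) × (Fin n →₀ ℕ)) := {p | φ p.1 = φ p.2}
  -- By Hilbert's basis theorem, finitely many of the binomials given by the kernel congruence
  -- generate their ideal; the corresponding pairs form R.
  obtain ⟨t, htK, ht⟩ := (Submodule.fg_span_iff_fg_span_finset_subset (δ '' K)).1
    (IsNoetherian.noetherian (Ideal.span (δ '' K)))
  obtain ⟨R, hRK, hRt⟩ := Finset.subset_set_image_iff.1 htK
  refine ⟨n, φ, R, hφ, R.finite_toSet, le_antisymm ?_ ?_⟩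
  · exact AddCon.addConGen_le.2 fun x y hxy => hRK hxy
  · intro x y hxy
    let c := addConGen fun x y => (x, y) ∈ (R : Set ((Fin n →₀ ℕ) × (Fin n →₀ ℕ)))
    -- F kills the generators from R, hence every binomial of the kernel congruence, and distinct
    -- classes modulo c give distinct monomials.
    let F := AddMonoidAlgebra.mapDomainRingHom ℤ c.mk'
    have hF : ∀ p, F (δ p) = AddMonoidAlgebra.single (p.1 : c.Quotient) 1
        - AddMonoidAlgebra.single (p.2 : c.Quotient) 1 := by
      intro p
      rw [map_sub, AddMonoidAlgebra.mapDomainRingHom_apply, AddMonoidAlgebra.mapDomainRingHom_apply,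
        AddMonoidAlgebra.mapDomain_single, AddMonoidAlgebra.mapDomain_single]
      rfl
    have hle : Ideal.span (δ '' K) ≤ RingHom.ker F := by
      refine ht.le.trans (Ideal.span_le.2 ?_)
      intro z hz
      rw [← hRt] at hz
      obtain ⟨p, hp, rfl⟩ := by simpa only [Finset.coe_image] using hz
      rw [SetLike.mem_coe, RingHom.mem_ker, hF, sub_eq_zero]
      congr 1
      exact (AddCon.eq c).2 (AddConGen.Rel.of _ _ hp)
    have h0 : F (δ (x, y)) = 0 := hle (Ideal.subset_span ⟨(x, y), hxy, rfl⟩)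
    rw [hF, sub_eq_zero] at h0
    exact (AddCon.eq c).1 (AddMonoidAlgebra.single_left_injective one_ne_zero h0)

/-- The union of an increasing chain of submonoids is its inductive limit. -/
theorem isInductiveLimit_of_coe_eq_iUnion {M ι : Type*} [AddCommMonoid M] [LinearOrder ι]
    [Nonempty ι] {A : ι → AddSubmonoid M} (hA : Monotone A) {T : AddSubmonoid M}
    (hT : (T : Set M) = ⋃ k, (A k : Set M)) : IsInductiveLimit.{u} A T := by
  have hle : ∀ k, A k ≤ T := fun k x hx => by
    have : x ∈ (T : Set M) := by
      rw [hT]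
      exact Set.mem_iUnion.2 ⟨k, hx⟩
    exact this
  have hex : ∀ x : T, ∃ k, (x : M) ∈ A k := fun x => by
    have : (x : M) ∈ (T : Set M) := x.2
    rw [hT] at this
    exact Set.mem_iUnion.1 this
  refine ⟨hle, fun N _ f hf => ?_⟩
  choose κ hκ using hex
  have key : ∀ (j k : ι) (x : M) (hj : x ∈ A j) (hk : x ∈ A k), f j ⟨x, hj⟩ = f k ⟨x, hk⟩ := by
    intro j k x hj hk
    rcases le_total j k with h | h
    · exact (hf j k h x hj hk).symm
    · exact hf k j h x hk hj
  let g : T →+ N :=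
    { toFun := fun x => f (κ x) ⟨x, hκ x⟩
      map_zero' := (key _ (κ 0) _ _ (zero_mem _)).trans (map_zero (f (κ 0)))
      map_add' := fun x y => by
        have hx := hA (le_max_left (κ x) (κ y)) (hκ x)
        have hy := hA (le_max_right (κ x) (κ y)) (hκ y)
        rw [key _ _ _ (hκ x) hx, key _ _ _ (hκ y) hy, ← map_add]
        exact key _ _ _ _ (add_mem hx hy) }
  refine ⟨g, fun k x => key _ _ _ _ x.2, fun g' hg' => ?_⟩
  ext x
  exact hg' (κ x) ⟨x, hκ x⟩

/-! ### Lex-minimal extensions as tight indices -/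

/-- The partial sums of a sequence. -/
def psum (e : ℕ → ℕ) (n : ℕ) : ℕ := ∑ i ∈ Finset.range n, e i

theorem psum_zero (e : ℕ → ℕ) : psum e 0 = 0 := rfl

theorem psum_succ (e : ℕ → ℕ) (n : ℕ) : psum e (n + 1) = psum e n + e n :=
  Finset.sum_range_succ e n

theorem psum_add (e e' : ℕ → ℕ) (n : ℕ) : psum (e + e') n = psum e n + psum e' n :=
  Finset.sum_add_distrib

theorem psum_zero_left (n : ℕ) : psum 0 n = 0 := Finset.sum_const_zero

theorem eq_of_psum_eq {e e' : ℕ → ℕ} (h : ∀ n, psum e n = psum e' n) : e = e' := by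
  funext n
  have h1 := h (n + 1)
  rw [psum_succ, psum_succ, h n] at h1
  omega

theorem psum_congr {e e' : ℕ → ℕ} {n : ℕ} (h : ∀ i < n, e i = e' i) : psum e n = psum e' n :=
  Finset.sum_congr rfl fun i hi => h i (Finset.mem_range.1 hi)

theorem isBinomid_iff_psum {e : ℕ → ℕ} :
    IsBinomid e ↔ ∀ i j, psum e i + psum e j ≤ psum e (i + j) := isBinomid_iff e

theorem IsBinomid.psum_add_le {e : ℕ → ℕ} (he : IsBinomid e) (i j : ℕ) :
    psum e i + psum e j ≤ psum e (i + j) := (isBinomid_iff e).1 he i j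

theorem IsBinomid.psum_add_psum_sub_le {e : ℕ → ℕ} (he : IsBinomid e) {i n : ℕ} (h : i ≤ n) :
    psum e i + psum e (n - i) ≤ psum e n := by
  have := he.psum_add_le i (n - i)
  rwa [Nat.add_sub_cancel' h] at this

theorem isBinomid_zero : IsBinomid 0 := isBinomid_iff_psum.2 fun i j => by simp [psum_zero_left]

theorem IsBinomid.add {e e' : ℕ → ℕ} (he : IsBinomid e) (he' : IsBinomid e') :
    IsBinomid (e + e') := isBinomid_iff_psum.2 fun i j => by
  have := he.psum_add_le i j
  have := he'.psum_add_le i j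
  simp only [psum_add]
  omega

/-- The initial segment of a binomid index. -/
def IsBinomid.restrict {e : ℕ → ℕ} (he : IsBinomid e) (k : ℕ) : FinIndex k :=
  ⟨fun i => e i, fun l n hl hln hn => by
    rw [sum_lt_eq _ e (fun _ => rfl) l (by omega), sum_between_eq _ e (fun _ => rfl) _ n hn]
    exact he l n hl hln⟩

/-- A binomid index is `k`-tight if each partial sum beyond position `k` splits as the sum of two
earlier ones. -/
def IsTight (k : ℕ) (e : ℕ → ℕ) : Prop :=
  IsBinomid e ∧ ∀ n, k < n → ∃ i, 0 < i ∧ i < n ∧ psum e n = psum e i + psum e (n - i)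

theorem IsTight.isLexMinExt {k : ℕ} {e : ℕ → ℕ} (he : IsTight k e) :
    IsLexMinExt (he.1.restrict k).1 e := by
  refine ⟨he.1, fun _ => rfl, fun e' hb hx => ?_⟩
  by_contra hlt
  obtain ⟨n, hn, hlt⟩ := not_le.1 hlt
  have hn' : ∀ j < n, e' j = e j := hn
  have hlt' : e' n < e n := hlt
  have hnk : k ≤ n := by
    by_contra hc
    have h1 : e' n = e n := hx ⟨n, by omega⟩
    omega
  have hS : ∀ j ≤ n, psum e' j = psum e j := fun j hj => psum_congr fun i hi => hn' i (by omega)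
  -- At the first difference n, the tight splitting of n + 1 involves only partial sums shared with
  -- e', so superadditivity of e' forbids a smaller entry.
  obtain ⟨i, h0, hi, heq⟩ := he.2 (n + 1) (by omega)
  have h1 := hb.psum_add_psum_sub_le (i := i) (n := n + 1) (by omega)
  rw [hS _ (by omega), hS _ (by omega), ← heq, psum_succ, psum_succ, hS n le_rfl] at h1
  omega

theorem isTight_L (k : ℕ+) (μ : FinIndex k) : IsTight k (L k μ) := by
  have hadd := greedySum_add μ.1 μ.2
  have hmono : Monotone (greedySum μ.1) := by
    intro a b hab
    have := hadd a (b - a)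
    rw [Nat.add_sub_cancel' hab] at this
    omega
  let e : ℕ → ℕ := fun n => greedySum μ.1 (n + 1) - greedySum μ.1 n
  have hsum : ∀ n, psum e n = greedySum μ.1 n := by
    intro n
    rw [psum, Finset.sum_range_tsub hmono, greedySum_zero, Nat.sub_zero]
  have hext : Extends e μ.1 := by
    intro i
    let e' : ℕ → ℕ := fun l => if h : l < k then μ.1 ⟨l, h⟩ else 0
    have he : Extends e' μ.1 := fun l => by simp [e']
    have hi := i.2
    change greedySum μ.1 (i + 1) - greedySum μ.1 i = μ.1 i
    rw [greedySum_le μ.1 _ (by omega), greedySum_le μ.1 _ (by omega),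
      sum_lt_eq μ.1 e' he _ (by omega), sum_lt_eq μ.1 e' he _ (by omega), Finset.sum_range_succ,
      he i]
    omega
  have ht : IsTight k e := by
    refine ⟨isBinomid_iff_psum.2 fun i j => ?_, fun n hn => ?_⟩
    · simp only [hsum]
      exact hadd i j
    -- Positivity of k gives n ≥ 2; for n = 1 the supremum would range over the empty set.
    · have hk := k.pos
      have hne : (Finset.Ico 1 n).attach.Nonempty :=
        ⟨⟨1, Finset.mem_Ico.2 (by omega)⟩, Finset.mem_attach _ _⟩
      obtain ⟨i, -, hi⟩ := Finset.exists_mem_eq_sup _ hne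
        fun i : {x // x ∈ Finset.Ico 1 n} => greedySum μ.1 i.1 + greedySum μ.1 (n - i.1)
      have := Finset.mem_Ico.1 i.2
      refine ⟨i, by omega, by omega, ?_⟩
      simp only [hsum]
      conv_lhs => rw [greedySum, if_neg (by omega)]
      exact hi
  have hμ : (ht.1.restrict k).1 = μ.1 := funext hext
  have h := ht.isLexMinExt
  rw [hμ] at h
  rwa [isLexMinExt_unique (L_spec k μ) h]

theorem mem_range_L {k : ℕ+} {e : ℕ → ℕ} : e ∈ Set.range (L k) ↔ IsTight k e := by
  constructor
  · rintro ⟨μ, rfl⟩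
    exact isTight_L k μ
  · intro h
    exact ⟨_, isLexMinExt_unique (L_spec k _) h.isLexMinExt⟩

theorem IsTight.mono {j k : ℕ} (h : j ≤ k) {e : ℕ → ℕ} (he : IsTight j e) : IsTight k e :=
  ⟨he.1, fun n hn => he.2 n (by omega)⟩

theorem range_L_mono : Monotone fun k : ℕ+ => Set.range (L k) := fun _ _ h _ he =>
  mem_range_L.2 ((mem_range_L.1 he).mono h)

theorem spanL_mono : Monotone spanL := fun _ _ h => AddSubmonoid.closure_mono (range_L_mono h)

theorem isTight_zero (k : ℕ) (hk : 0 < k) : IsTight k 0 :=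
  ⟨isBinomid_zero, fun n hn => ⟨1, one_pos, by omega, by simp [psum_zero_left]⟩⟩

/-! ### Decomposition into atoms -/

/-- Summands of a `k`-tight binomid index are `k`-tight. -/
theorem IsTight.of_add_left {k : ℕ} {a b : ℕ → ℕ} (h : IsTight k (a + b)) (ha : IsBinomid a)
    (hb : IsBinomid b) : IsTight k a := by
  refine ⟨ha, fun n hn => ?_⟩
  obtain ⟨i, h0, hi, heq⟩ := h.2 n hn
  refine ⟨i, h0, hi, ?_⟩
  -- The two superadditive inequalities add up to an equality, so each is an equality.
  have h1 := ha.psum_add_psum_sub_le hi.le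
  have h2 := hb.psum_add_psum_sub_le hi.le
  simp only [psum_add] at heq
  omega

/-- A nonzero `k`-tight binomid index has a nonzero entry among the first `k`. -/
theorem IsTight.eq_zero {k : ℕ} {e : ℕ → ℕ} (h : IsTight k e) (h0 : psum e k = 0) : e = 0 := by
  refine eq_of_psum_eq fun n => ?_
  rw [psum_zero_left]
  induction n using Nat.strong_induction_on with
  | _ n ih =>
    by_cases hn : n ≤ k
    · have := h.1.psum_add_psum_sub_le hn
      omega
    · obtain ⟨i, h1, h2, h3⟩ := h.2 n (by omega)
      rw [h3, ih i h2, ih (n - i) (by omega)]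

/-- Induction on the k-th partial sum: nonzero summands of a k-tight index are k-tight, so theirs
are positive and both strictly smaller. -/
theorem IsTight.mem_closure_atom {k : ℕ+} {e : ℕ → ℕ} (he : IsTight k e) :
    e ∈ AddSubmonoid.closure (Atom ∩ Set.range (L k)) := by
  induction hm : psum e k using Nat.strong_induction_on generalizing e with
  | _ m ih =>
    by_cases h0 : e = 0
    · rw [h0]
      exact zero_mem _
    by_cases ha : e ∈ Atom
    · exact AddSubmonoid.subset_closure ⟨ha, mem_range_L.2 he⟩
    have : ∃ e₁ e₂ : ℕ → ℕ, IsBinomid e₁ ∧ IsBinomid e₂ ∧ e₁ ≠ 0 ∧ e₂ ≠ 0 ∧ e = e₁ + e₂ := by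
      by_contra hc
      exact ha ⟨he.1, h0, hc⟩
    obtain ⟨a, b, hab, hbb, ha0, hb0, rfl⟩ := this
    have hta := he.of_add_left hab hbb
    have htb := IsTight.of_add_left (add_comm a b ▸ he) hbb hab
    have h1 : psum a k ≠ 0 := fun h => ha0 (hta.eq_zero h)
    have h2 : psum b k ≠ 0 := fun h => hb0 (htb.eq_zero h)
    rw [psum_add] at hm
    exact add_mem (ih _ (by omega) hta rfl) (ih _ (by omega) htb rfl)

theorem closure_atom_inter_range_L (k : ℕ+) :
    AddSubmonoid.closure (Atom ∩ Set.range (L k)) = spanL k :=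
  le_antisymm (AddSubmonoid.closure_mono Set.inter_subset_right)
    (AddSubmonoid.closure_le.2 fun _ he => (mem_range_L.1 he).mem_closure_atom)


/-! ### Eventual quasi-linearity and closure under addition -/

theorem IsBinomid.mul_psum_le {e : ℕ → ℕ} (he : IsBinomid e) (q d : ℕ) :
    q * psum e d ≤ psum e (q * d) := by
  induction q with
  | zero => simp
  | succ q ih =>
    have := he.psum_add_le (q * d) d
    rw [add_mul, one_mul, add_mul, one_mul]
    omega

/-- Some `d ≤ k` maximizes `psum e d / d`. -/
theorem IsTight.exists_slope {k : ℕ} (hk : 0 < k) {e : ℕ → ℕ} (h : IsTight k e) :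
    ∃ d, 0 < d ∧ d ≤ k ∧ ∀ n, psum e n * d ≤ psum e d * n := by
  obtain ⟨d, hd, hmax⟩ := Finset.exists_max_image (Finset.Icc 1 k)
    (fun d => (psum e d : ℚ) / d) ⟨1, Finset.mem_Icc.2 (by omega)⟩
  have hd' := Finset.mem_Icc.1 hd
  refine ⟨d, by omega, hd'.2, fun n => ?_⟩
  induction n using Nat.strong_induction_on with
  | _ n ih =>
    rcases Nat.eq_zero_or_pos n with rfl | hn
    · simp [psum_zero]
    by_cases hnk : n ≤ k
    · have h1 := hmax n (Finset.mem_Icc.2 ⟨hn, hnk⟩)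
      rw [div_le_div_iff₀ (by exact_mod_cast hn) (by exact_mod_cast hd'.1)] at h1
      exact_mod_cast h1
    · obtain ⟨i, h1, h2, h3⟩ := h.2 n (by omega)
      have h4 := ih i h2
      have h5 := ih (n - i) (by omega)
      calc psum e n * d = psum e i * d + psum e (n - i) * d := by rw [h3, add_mul]
        _ ≤ psum e d * i + psum e d * (n - i) := add_le_add h4 h5
        _ = psum e d * n := by rw [← mul_add, Nat.add_sub_cancel' h2.le]

/-- A part of size at most `k` splits off tightly from every positive position. -/
theorem IsTight.exists_small_part {k : ℕ} (hk : 0 < k) {e : ℕ → ℕ} (h : IsTight k e) (n : ℕ) :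
    ∃ m, m ≤ n ∧ n ≤ m + k ∧ (0 < n → m < n) ∧ psum e n = psum e m + psum e (n - m) := by
  induction n using Nat.strong_induction_on with
  | _ n ih =>
    by_cases hnk : n ≤ k
    · exact ⟨0, by omega, by omega, fun h => h, by simp [psum_zero]⟩
    · obtain ⟨i, h1, h2, h3⟩ := h.2 n (by omega)
      obtain ⟨m, h4, h5, h6, h7⟩ := ih i h2
      have h8 := h6 h1
      -- The small part i - m of i is split off from n instead: n = (m + (n - i)) + (i - m), and
      -- superadditivity keeps the regrouping tight.
      refine ⟨n - (i - m), by omega, by omega, fun _ => by omega, ?_⟩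
      have h9 := h.1.psum_add_psum_sub_le (i := n - i) (n := n - (i - m)) (by omega)
      have h10 := h.1.psum_add_psum_sub_le (i := n - (i - m)) (n := n) (by omega)
      rw [show n - (i - m) - (n - i) = m by omega] at h9
      rw [show n - (n - (i - m)) = i - m by omega] at h10 ⊢
      omega

/-- Beyond position `k * k`, the partial sums of a `k`-tight index are quasi-linear. -/
theorem IsTight.exists_period {k : ℕ} (hk : 0 < k) {e : ℕ → ℕ} (h : IsTight k e) :
    ∃ d, 0 < d ∧ d ≤ k ∧ ∀ n, k * k < n → psum e n = psum e d + psum e (n - d) := by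
  obtain ⟨d, hd0, hdk, hd⟩ := h.exists_slope hk
  refine ⟨d, hd0, hdk, fun n hn => ?_⟩
  choose g hg1 hg2 hg3 hg4 using h.exists_small_part hk
  -- Small parts are removed repeatedly. Since n > k * k and d ≤ k, the positions s 0, ..., s d are
  -- positive, hence strictly decreasing.
  let s : ℕ → ℕ := fun j => g^[j] n
  have hs : ∀ j, s (j + 1) = g (s j) := fun j => Function.iterate_succ_apply' g j n
  have hanti : Antitone s := antitone_nat_of_succ_le fun j => hs j ▸ hg1 _
  have hlow : ∀ j, n ≤ s j + j * k := by
    intro j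
    induction j with
    | zero => simp [s]
    | succ j ih =>
      have := hg2 (s j)
      rw [hs, add_mul, one_mul]
      omega
  have hpos : ∀ j ≤ d, 0 < s j := by
    intro j hj
    have h1 := hlow j
    have h2 : j * k ≤ k * k := Nat.mul_le_mul_right k (hj.trans hdk)
    omega
  have hstrict : ∀ i j, i < j → j ≤ d → s j < s i := by
    intro i j hij hj
    have h1 : s (i + 1) < s i := hs i ▸ hg3 _ (hpos i (by omega))
    exact (hanti (show i + 1 ≤ j from hij)).trans_lt h1
  have hsplit : ∀ i j, i ≤ j → psum e (s i) = psum e (s j) + psum e (s i - s j) := by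
    intro i j hij
    induction j, hij using Nat.le_induction with
    | base => simp [psum_zero]
    | succ j hij ih =>
      have h1 := hg4 (s j)
      rw [← hs] at h1
      have h2 := hanti hij
      have h3 : s (j + 1) ≤ s j := hanti (Nat.le_succ j)
      have h4 := h.1.psum_add_le (s j - s (j + 1)) (s i - s j)
      rw [show s j - s (j + 1) + (s i - s j) = s i - s (j + 1) by omega] at h4
      have h5 := h.1.psum_add_psum_sub_le (h3.trans h2)
      omega
  -- Pigeonhole on d + 1 residues modulo d: the removed parts between s j and s i have total size a
  -- positive multiple of d.
  obtain ⟨i, j, hij, hj, hmod⟩ : ∃ i j, i < j ∧ j ≤ d ∧ s i ≡ s j [MOD d] := by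
    obtain ⟨x, hx, y, hy, hne, heq⟩ := Finset.exists_ne_map_eq_of_card_lt_of_maps_to
      (s := Finset.range (d + 1)) (t := Finset.range d) (f := fun j => s j % d) (by simp)
      fun j _ => Finset.mem_coe.2 (Finset.mem_range.2 (Nat.mod_lt _ hd0))
    rw [Finset.mem_range] at hx hy
    rcases lt_or_gt_of_ne hne with hlt | hlt
    · exact ⟨x, y, hlt, by omega, heq⟩
    · exact ⟨y, x, hlt, by omega, heq.symm⟩
  have hlt := hstrict i j hij hj
  obtain ⟨q, hq⟩ := (Nat.modEq_iff_dvd' hlt.le).1 hmod.symm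
  obtain ⟨q, rfl⟩ : ∃ r, q = r + 1 := Nat.exists_eq_succ_of_ne_zero (by rintro rfl; omega)
  have hin : s i ≤ n := hanti (Nat.zero_le i)
  have h1 : psum e n = psum e (s i) + psum e (n - s i) := hsplit 0 i (Nat.zero_le i)
  have h2 := hsplit i j hij.le
  -- By maximality of the slope, q + 1 copies of d contribute at least as much as this block, so one
  -- copy of d can be split off from n without loss.
  have h3 : psum e (s i - s j) ≤ (q + 1) * psum e d := by
    have := hd (s i - s j)
    refine Nat.le_of_mul_le_mul_right (this.trans_eq ?_) hd0
    rw [hq]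
    ring
  have h4 := h.1.mul_psum_le q d
  have hqd : (q + 1) * d = s i - s j := by rw [hq, mul_comm]
  rw [add_mul, one_mul] at h3 hqd
  have h5 := h.1.psum_add_le (q * d) (s j)
  have h6 := h.1.psum_add_le (q * d + s j) (n - s i)
  rw [show q * d + s j + (n - s i) = n - d by omega] at h6
  have h7 := h.1.psum_add_psum_sub_le (i := d) (n := n) (by omega)
  omega

theorem IsBinomid.psum_eq_of_period {e : ℕ → ℕ} (he : IsBinomid e) {d N : ℕ}
    (h : ∀ n, N < n → psum e n = psum e d + psum e (n - d)) (j n : ℕ) (hn : N + j * d < n) :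
    psum e n = psum e (j * d) + psum e (n - j * d) := by
  induction j generalizing n with
  | zero => simp [psum_zero]
  | succ j ih =>
    rw [add_mul, one_mul] at hn ⊢
    have h1 := h n (by omega)
    have h2 := ih (n - d) (by omega)
    have h3 := he.psum_add_le (j * d) d
    have h4 := he.psum_add_psum_sub_le (i := j * d + d) (n := n) (by omega)
    rw [show n - d - j * d = n - (j * d + d) by omega] at h2
    omega

theorem IsTight.exists_add {k : ℕ} (hk : 0 < k) {a b : ℕ → ℕ} (ha : IsTight k a)
    (hb : IsTight k b) : ∃ m : ℕ+, IsTight m (a + b) := by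
  obtain ⟨d, hd0, -, hd⟩ := ha.exists_period hk
  obtain ⟨c, hc0, -, hc⟩ := hb.exists_period hk
  have hcd : 0 < c * d := Nat.mul_pos hc0 hd0
  -- The common multiple c * d of both periods splits off from both summands once n exceeds k * k by
  -- more than c * d.
  refine ⟨⟨k * k + c * d, by omega⟩, ha.1.add hb.1, fun n hn => ?_⟩
  have hn : k * k + c * d < n := hn
  refine ⟨c * d, hcd, by omega, ?_⟩
  have h1 := ha.1.psum_eq_of_period hd c n hn
  have h2 := hb.1.psum_eq_of_period hc d n (by rwa [mul_comm d c])
  rw [mul_comm d c] at h2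
  simp only [psum_add]
  omega

theorem mem_lexMin {e : ℕ → ℕ} : e ∈ LexMin ↔ ∃ k : ℕ+, IsTight k e :=
  exists_congr fun k => ⟨fun ⟨μ, h⟩ => h ▸ isTight_L k μ, fun h => by
    obtain ⟨μ, hμ⟩ := mem_range_L.2 h
    exact ⟨μ, hμ.symm⟩⟩

/-- The monoid of all lex-minimal extensions. -/
def lexMinSubmonoid : AddSubmonoid (ℕ → ℕ) where
  carrier := LexMin
  zero_mem' := mem_lexMin.2 ⟨1, isTight_zero 1 one_pos⟩
  add_mem' := by
    intro a b ha hb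
    obtain ⟨j, hj⟩ := mem_lexMin.1 ha
    obtain ⟨k, hk⟩ := mem_lexMin.1 hb
    exact mem_lexMin.2 (IsTight.exists_add (max j k).pos (hj.mono (le_max_left j k))
      (hk.mono (le_max_right j k)))

theorem lexMin_eq_iUnion : LexMin = ⋃ k : ℕ+, (spanL k : Set (ℕ → ℕ)) := by
  refine Set.Subset.antisymm (fun e he => ?_) (Set.iUnion_subset fun k => ?_)
  · obtain ⟨k, hk⟩ := mem_lexMin.1 he
    exact Set.mem_iUnion.2 ⟨k, AddSubmonoid.subset_closure (mem_range_L.2 hk)⟩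
  · exact (AddSubmonoid.closure_le (S := lexMinSubmonoid)).2 fun e he =>
      mem_lexMin.2 ⟨k, mem_range_L.1 he⟩

/-! ### Faces and finite generation -/

/-- The binomid indices whose partial sums split beyond position `k` as prescribed by `c`. -/
def face (k : ℕ) (c : ℕ → ℕ) : AddSubmonoid (ℕ → ℕ) where
  carrier := {e | IsBinomid e ∧ ∀ n, k < n → psum e n = psum e (c n) + psum e (n - c n)}
  zero_mem' := ⟨isBinomid_zero, fun n _ => by simp [psum_zero_left]⟩
  add_mem' := by
    rintro a b ⟨ha, ha'⟩ ⟨hb, hb'⟩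
    refine ⟨ha.add hb, fun n hn => ?_⟩
    simp only [psum_add, ha' n hn, hb' n hn]
    omega

section Face

variable {k N d : ℕ} {c : ℕ → ℕ}

theorem psum_eq_of_mem_face (hN : k ≤ N) (hc : ∀ n, N < n → c n = d) {e : ℕ → ℕ}
    (he : e ∈ face k c) {n : ℕ} (hn : N < n) : psum e n = psum e d + psum e (n - d) := by
  have := he.2 n (by omega)
  rwa [hc n hn] at this

theorem apply_eq_of_mem_face (hN : k ≤ N) (hdN : d ≤ N) (hc : ∀ n, N < n → c n = d)
    {e : ℕ → ℕ} (he : e ∈ face k c) {n : ℕ} (hn : N < n) : e n = e (n - d) := by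
  have h1 := psum_eq_of_mem_face hN hc he hn
  have h2 := psum_eq_of_mem_face hN hc he (show N < n + 1 by omega)
  rw [show n + 1 - d = n - d + 1 by omega, psum_succ, psum_succ] at h2
  omega

/-- Reducing an argument above N by d removes `psum e d` from both sides, so superadditivity need
only be checked on a finite square. -/
theorem psum_add_le_of_period (hd : 0 < d) (hdN : d ≤ N) {e : ℕ → ℕ}
    (h : ∀ n, N < n → psum e n = psum e d + psum e (n - d))
    (hle : ∀ i j, i ≤ N → j ≤ N → psum e i + psum e j ≤ psum e (i + j)) (i j : ℕ) :
    psum e i + psum e j ≤ psum e (i + j) := by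
  induction hs : i + j using Nat.strong_induction_on generalizing i j with
  | _ s ih =>
    subst hs
    by_cases hi : i ≤ N
    · by_cases hj : j ≤ N
      · exact hle i j hi hj
      · have h1 := h j (by omega)
        have h2 := h (i + j) (by omega)
        have h3 := ih _ (by omega) i (j - d) rfl
        rw [show i + (j - d) = i + j - d by omega] at h3
        omega
    · have h1 := h i (by omega)
      have h2 := h (i + j) (by omega)
      have h3 := ih _ (by omega) (i - d) j rfl
      rw [show i - d + j = i + j - d by omega] at h3
      omega

/-- The first entries of an element of a face, together with the slacks in the inequalities that
define binomid indices. -/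
def faceCoords (k N : ℕ) (c : ℕ → ℕ) :
    face k c →+ (Fin (N + 1) ⊕ Fin (N + 1) × Fin (N + 1) → ℕ) where
  toFun e := Sum.elim (fun i => e.1 i)
    fun p => psum e.1 (p.1 + p.2) - (psum e.1 p.1 + psum e.1 p.2)
  map_zero' := by
    ext (i | p)
    · rfl
    · simp [psum_zero_left]
  map_add' := by
    rintro ⟨a, ha⟩ ⟨b, hb⟩
    ext (i | p)
    · rfl
    · have h1 := ha.1.psum_add_le p.1 p.2
      have h2 := hb.1.psum_add_le p.1 p.2
      simp only [AddMemClass.mk_add_mk, psum_add, Sum.elim_inr, Pi.add_apply]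
      omega

theorem faceCoords_inr (e : face k c) {i j : ℕ} (hi : i ≤ N) (hj : j ≤ N) :
    faceCoords k N c e (Sum.inr (⟨i, by omega⟩, ⟨j, by omega⟩)) =
      psum e.1 (i + j) - (psum e.1 i + psum e.1 j) := rfl

theorem faceCoords_injective (hN : k ≤ N) (hd : 0 < d) (hdN : d ≤ N)
    (hc : ∀ n, N < n → c n = d) : Function.Injective (faceCoords k N c) := by
  intro a b hab
  refine Subtype.ext (funext fun n => ?_)
  induction n using Nat.strong_induction_on with
  | _ n ih =>
    by_cases hn : n ≤ N
    · exact congrFun hab (Sum.inl ⟨n, by omega⟩)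
    · rw [apply_eq_of_mem_face hN hdN hc a.2 (by omega),
        apply_eq_of_mem_face hN hdN hc b.2 (by omega), ih _ (by omega)]

/-- The slack coordinates make the difference b - a superadditive on the finite square, hence
everywhere; the splitting equations are linear and pass to the difference. -/
theorem exists_add_eq_of_faceCoords_le (hN : k ≤ N) (hd : 0 < d) (hdN : d ≤ N)
    (hc : ∀ n, N < n → c n = d) {a b : face k c}
    (hab : faceCoords k N c a ≤ faceCoords k N c b) : ∃ x, a + x = b := by
  have hle : ∀ n, a.1 n ≤ b.1 n := by
    intro n
    induction n using Nat.strong_induction_on with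
    | _ n ih =>
      by_cases hn : n ≤ N
      · exact hab (Sum.inl ⟨n, by omega⟩)
      · rw [apply_eq_of_mem_face hN hdN hc a.2 (by omega),
          apply_eq_of_mem_face hN hdN hc b.2 (by omega)]
        exact ih _ (by omega)
  let x : ℕ → ℕ := fun n => b.1 n - a.1 n
  have hx : a.1 + x = b.1 := funext fun n => Nat.add_sub_cancel' (hle n)
  have hS : ∀ n, psum b.1 n = psum a.1 n + psum x n := fun n => by rw [← hx, psum_add]
  have htight : ∀ n, k < n → psum x n = psum x (c n) + psum x (n - c n) := by
    intro n hn
    have h1 := a.2.2 n hn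
    have h2 := b.2.2 n hn
    simp only [hS] at h2
    omega
  have hbin : IsBinomid x := by
    refine isBinomid_iff_psum.2 (psum_add_le_of_period hd hdN (N := N) ?_ ?_)
    · intro n hn
      have := htight n (by omega)
      rwa [hc n hn] at this
    · intro i j hi hj
      have h1 := hab (Sum.inr (⟨i, by omega⟩, ⟨j, by omega⟩))
      rw [faceCoords_inr a hi hj, faceCoords_inr b hi hj] at h1
      have h2 := a.2.1.psum_add_le i j
      have h3 := b.2.1.psum_add_le i j
      simp only [hS] at h1 h3
      omega
  exact ⟨⟨x, hbin, htight⟩, Subtype.ext hx⟩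

theorem face_fg (hN : k ≤ N) (hd : 0 < d) (hdN : d ≤ N) (hc : ∀ n, N < n → c n = d) :
    (face k c).FG := by
  have h1 : (AddMonoidHom.mrange (faceCoords k N c)).FG := by
    -- A submonoid of a finite power of ℕ closed under those differences that stay in it is
    -- generated by its minimal nonzero elements, which are finitely many by Dickson's lemma.
    refine AddSubmonoid.fg_of_subtractive ?_
    rintro _ ⟨a, rfl⟩ y ⟨b, hb⟩
    obtain ⟨x, rfl⟩ := exists_add_eq_of_faceCoords_le hN hd hdN hc
      (a := a) (b := b) (hb ▸ le_self_add)
    rw [map_add] at hb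
    exact ⟨x, add_left_cancel hb⟩
  have h2 := (AddMonoid.fg_iff_addSubmonoid_fg _).2 h1
  let E := AddEquiv.ofBijective (faceCoords k N c).mrangeRestrict
    ⟨fun a b h => faceCoords_injective hN hd hdN hc (congrArg Subtype.val h),
      (faceCoords k N c).mrangeRestrict_surjective⟩
  exact (AddMonoid.fg_iff_addSubmonoid_fg _).1
    (AddMonoid.fg_of_surjective E.symm.toAddMonoidHom E.symm.surjective)

end Face

/-- The split function with values `t` up to `N` and constant value `d` beyond. -/
def splitAt {N : ℕ} (t : Fin (N + 1) → Fin (N + 1)) (d n : ℕ) : ℕ :=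
  if h : n ≤ N then t ⟨n, by omega⟩ else d

theorem splitAt_of_lt {N : ℕ} (t : Fin (N + 1) → Fin (N + 1)) (d : ℕ) {n : ℕ} (hn : N < n) :
    splitAt t d n = d := dif_neg (by omega)

theorem splitAt_of_le {N : ℕ} (t : Fin (N + 1) → Fin (N + 1)) (d : ℕ) {n : ℕ} (hn : n ≤ N) :
    splitAt t d n = t ⟨n, by omega⟩ := dif_pos hn

/-- The range of `L k` is a finite union of faces: a pattern is a table of splits up to k * k and
one period beyond. -/
theorem spanL_fg (k : ℕ+) : (spanL k).FG := by
  let N : ℕ := k * k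
  have hk := k.pos
  have hkN : (k : ℕ) ≤ N := Nat.le_mul_of_pos_left _ hk
  -- The bounds on the split say exactly that it is a genuine one, so that elements of the face are
  -- k-tight.
  let I := {p : (Fin (N + 1) → Fin (N + 1)) × Fin (N + 1) //
    0 < p.2.val ∧ ∀ n, (k : ℕ) < n → 0 < splitAt p.1 p.2 n ∧ splitAt p.1 p.2 n < n}
  have heq : spanL k = ⨆ p : I, face k (splitAt p.1.1 p.1.2) := by
    refine le_antisymm (AddSubmonoid.closure_le.2 fun e he => ?_) (iSup_le fun p e he => ?_)
    · have ht := mem_range_L.1 he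
      obtain ⟨d, hd0, hdk, hd⟩ := ht.exists_period hk
      have hex : ∀ n : Fin (N + 1), ∃ i : Fin (N + 1), (k : ℕ) < n →
          0 < i.val ∧ i.val < n ∧ psum e n = psum e i + psum e (n - i) := by
        intro n
        by_cases hn : (k : ℕ) < n
        · obtain ⟨i, h1, h2, h3⟩ := ht.2 n hn
          exact ⟨⟨i, by omega⟩, fun _ => ⟨h1, h2, h3⟩⟩
        · exact ⟨0, fun h => absurd h hn⟩
      choose t ht' using hex
      let p : I := ⟨(t, ⟨d, by omega⟩), hd0, fun n hn => by
        by_cases hnN : n ≤ N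
        · rw [splitAt_of_le _ _ hnN]
          exact ⟨(ht' ⟨n, by omega⟩ hn).1, (ht' ⟨n, by omega⟩ hn).2.1⟩
        · rw [splitAt_of_lt _ _ (by omega)]
          exact ⟨hd0, hdk.trans_lt hn⟩⟩
      refine le_iSup (fun p : I => face k (splitAt p.1.1 p.1.2)) p ⟨ht.1, fun n hn => ?_⟩
      by_cases hnN : n ≤ N
      · rw [splitAt_of_le _ _ hnN]
        exact (ht' ⟨n, by omega⟩ hn).2.2
      · rw [splitAt_of_lt _ _ (by omega)]
        exact hd n (by omega)
    · exact AddSubmonoid.subset_closure (mem_range_L.2 ⟨he.1, fun n hn =>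
        ⟨_, (p.2.2 n hn).1, (p.2.2 n hn).2, he.2 n hn⟩⟩)
  rw [heq]
  exact AddSubmonoid.FG.iSup _ fun p => face_fg hkN p.2.1 (by omega)
    fun n hn => splitAt_of_lt _ _ hn

end Binomid

theorem mainTheorem7 :
    (∃ T : AddSubmonoid (ℕ → ℕ), (T : Set (ℕ → ℕ)) = Binomid.LexMin ∧
      (T : Set (ℕ → ℕ)) = ⋃ k : ℕ+, (Binomid.spanL k : Set (ℕ → ℕ)) ∧
      Binomid.IsInductiveLimit.{u} Binomid.spanL T) ∧
    Monotone Binomid.spanL ∧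
    (∀ k : ℕ+, Binomid.IsFinitelyPresented (Binomid.spanL k)) ∧
    Monotone (fun k : ℕ+ => Binomid.Atom ∩ Set.range (Binomid.L k)) ∧
    ∀ k : ℕ+, AddSubmonoid.closure (Binomid.Atom ∩ Set.range (Binomid.L k)) = Binomid.spanL k := by
  refine ⟨⟨Binomid.lexMinSubmonoid, rfl, Binomid.lexMin_eq_iUnion,
    Binomid.isInductiveLimit_of_coe_eq_iUnion Binomid.spanL_mono Binomid.lexMin_eq_iUnion⟩,
    Binomid.spanL_mono, fun k => ?_,
    fun _ _ h => Set.inter_subset_inter_right _ (Binomid.range_L_mono h),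
    Binomid.closure_atom_inter_range_L⟩
  have := (AddMonoid.fg_iff_addSubmonoid_fg _).2 (Binomid.spanL_fg k)
  exact Binomid.isFinitelyPresented_of_fg _
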